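/- Let $n\ge 1$, let $0<\alpha<n$ and put $r=\frac{n}{n-\alpha}$. Let $m$ be Lebesgue measure on $\mathbb R^n$ and $\sigma$ the area measure on the unit sphere $\mathbb S^{n-1}$ (counting measure on $\{\pm1\}$ if $n=1$). Let $\Omega$ be a real- or complex-valued function on $\mathbb R^n\setminus\{0\}$ such that (a) $\Omega(cx)=\Omega(x)$ for all $c>0$ and $x\neq 0$; (b) $\int_{\mathbb S^{n-1}}\Omega(\theta)\,d\sigma(\theta)=0$; (c) $\Omega$ satisfies the $L^r_\alpha$-Dini condition, that is, $\Omega\in L^r(\mathbb S^{n-1})$ and $$\int_0^1\frac{\omega_1(\delta)}{\delta^{1+\alpha}}\,d\delta<\infty,\qquad \omega_1(\delta)=\sup_{\|\rho\|\le\delta}\int_{\mathbb S^{n-1}}|\Omega(\rho\theta)-\Omega(\theta)|\,d\sigma(\theta),$$ where the supremum is over the rotations $\rho$ of $\mathbb R^n$ with $\|\rho\|:=\sup\{|\rho x'-x'|:x'\in\mathbb S^{n-1}\}\le\delta$. Let $f\in L^1(\mathbb R^n)$ with $f\ge 0$. Then the integral $$T_{\Omega,\alpha}f(x)=\int_{\mathbb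 R^n}\frac{\Omega(x-y)}{|x-y|^{n-\alpha}}f(y)\,dy$$ converges absolutely for almost every $x\in\mathbb R^n$, and $$\lim_{\lambda\to0+}\lambda^r\,m\big(\{x\in\mathbb R^n:|T_{\Omega,\alpha}f(x)|>\lambda\}\big)=\frac1n\,\|\Omega\|_r^r\,\|f\|_1^r,\qquad \|\Omega\|_r^r=\int_{\mathbb S^{n-1}}|\Omega(\theta)|^r\,d\sigma(\theta).$$ -/

import Mathlib

open MeasureTheory Filter Topology
open scoped ENNReal

noncomputable section

namespace RoughFractional

/-- The Euclidean space `ℝⁿ`. -/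
abbrev E (n : ℕ) : Type := EuclideanSpace ℝ (Fin n)

/-- The unit sphere `S^{n-1}` of `ℝⁿ`. -/
abbrev S (n : ℕ) : Type := Metric.sphere (0 : E n) 1

/-- The area measure on `S^{n-1}` (the measure `σ` of polar coordinates `dx = s^{n-1} ds dσ(θ)`). -/
def area (n : ℕ) : Measure (S n) := (volume : Measure (E n)).toSphere

/-- `Ω` is homogeneous of degree zero on `ℝⁿ \ {0}`. The value of `Ω` at the origin plays no role. -/
def HomogeneousDegreeZero {𝕜 : Type*} [RCLike 𝕜] {n : ℕ} (Ω : E n → 𝕜) : Prop :=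
  ∀ c : ℝ, 0 < c → ∀ x : E n, x ≠ 0 → Ω (c • x) = Ω x

/-- `Ω` has vanishing integral over the unit sphere. -/
def MeanZero {𝕜 : Type*} [RCLike 𝕜] {n : ℕ} (Ω : E n → 𝕜) : Prop :=
  ∫ θ : S n, Ω (θ : E n) ∂(area n) = 0

/-- A rotation of `ℝⁿ`: a linear isometry of determinant one. -/
def IsRotation {n : ℕ} (ρ : E n ≃ₗᵢ[ℝ] E n) : Prop :=
  LinearMap.det (ρ.toLinearEquiv : E n →ₗ[ℝ] E n) = 1

/-- `‖ρ‖ = sup {|ρ x' - x'| : x' ∈ S^{n-1}}`. -/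
def rotationSize {n : ℕ} (ρ : E n ≃ₗᵢ[ℝ] E n) : ℝ :=
  ⨆ x : S n, ‖ρ (x : E n) - (x : E n)‖

/-- The `L¹` integral modulus of continuity
`ω₁(δ) = sup_{‖ρ‖ ≤ δ} ∫_{S^{n-1}} |Ω(ρ θ) - Ω(θ)| dσ(θ)`, the supremum being over rotations. -/
def modulus {𝕜 : Type*} [RCLike 𝕜] {n : ℕ} (Ω : E n → 𝕜) (δ : ℝ) : ℝ≥0∞ :=
  ⨆ (ρ : E n ≃ₗᵢ[ℝ] E n) (_ : IsRotation ρ) (_ : rotationSize ρ ≤ δ),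
    ∫⁻ θ : S n, ‖Ω (ρ (θ : E n)) - Ω (θ : E n)‖ₑ ∂(area n)

/-- The `L^s_α`-Dini condition: `Ω ∈ L^s(S^{n-1})` and `∫₀¹ ω₁(δ) / δ^{1+α} dδ < ∞`. -/
structure DiniCondition {𝕜 : Type*} [RCLike 𝕜] {n : ℕ} (s : ℝ≥0∞) (α : ℝ) (Ω : E n → 𝕜) :
    Prop where
  memLp : MemLp (fun θ : S n => Ω (θ : E n)) s (area n)
  dini : ∫⁻ δ in Set.Ioo (0 : ℝ) 1, modulus Ω δ / ENNReal.ofReal (δ ^ (1 + α)) < ∞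

/-- The integrand `y ↦ Ω(x - y) |x - y|^{-(n-α)} f(y)` of the fractional integral at `x`. -/
def integrand {𝕜 : Type*} [RCLike 𝕜] {n : ℕ} (Ω : E n → 𝕜) (α : ℝ) (f : E n → ℝ) (x y : E n) :
    𝕜 :=
  Ω (x - y) / ((‖x - y‖ ^ ((n : ℝ) - α) : ℝ) : 𝕜) * (f y : 𝕜)

/-- The fractional integral operator with homogeneous kernel,
`T_{Ω,α} f(x) = ∫ Ω(x - y) |x - y|^{-(n-α)} f(y) dy`. -/
def fractionalIntegral {𝕜 : Type*} [RCLike 𝕜] {n : ℕ} (Ω : E n → 𝕜) (α : ℝ) (f : E n → ℝ)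
    (x : E n) : 𝕜 :=
  ∫ y : E n, integrand Ω α f x y

end RoughFractional

end

/-! Write `K z = Ω z / ‖z‖ ^ (n - α)`, homogeneous of degree `-(n - α)`. With `ε ^ (n - α) = t`, the
substitution `x = ε⁻¹ • u` turns `t ^ r` times the measure of `{|T f| > t}` into the measure of `{u
| 1 < |∫ K (u - ε y) f y dy|}`, because `ε ^ n = t ^ r`. As `ε → 0` the mass of `f` concentrates at
the origin, so the dilated convolution should tend to `K u * ∫ f`. Polar coordinates give `|{|K| >
s}| = s ^ (-r) ‖Ω‖_r ^ r / n`, which at `s = 1 / ∫ f` is the claimed limit.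

The convergence holds in measure (`tendsto_measure_dilated_convolution_sub`). Cut `K` at a small
height `η`: the low part contributes at most `2 η ‖f‖₁` everywhere, and the high part is in `L¹`
because `r > 1`, so continuity of translations and Markov's inequality control it. Since the
limiting distribution function is continuous, `tendsto_measure_lt_norm_of_tendsto_measure_sub`
transfers the limit to level `1`. -/

namespace RoughFractional

/-! ### Truncation of a kernel by height. -/

section HighPart

variable {V 𝕜 : Type*} [RCLike 𝕜]

/-- The part of `K` above height `η`. -/
noncomputable def highPart (K : V → 𝕜) (η : ℝ) : V → 𝕜 := {x | η < ‖K x‖}.indicator K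

lemma enorm_sub_highPart_le (K : V → 𝕜) {η : ℝ} (hη : 0 ≤ η) (x : V) :
    ‖K x - highPart K η x‖ₑ ≤ ENNReal.ofReal η := by
  rw [← ofReal_norm]
  refine ENNReal.ofReal_le_ofReal ?_
  unfold highPart
  by_cases h : η < ‖K x‖
  · simpa [Set.indicator_of_mem (show x ∈ {x | η < ‖K x‖} from h)] using hη
  · simpa [Set.indicator_of_notMem (show x ∉ {x | η < ‖K x‖} from h)] using h

lemma enorm_sub_le_add_highPart (K : V → 𝕜) {η : ℝ} (hη : 0 ≤ η) (x y : V) :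
    ‖K x - K y‖ₑ ≤ 2 * ENNReal.ofReal η + ‖highPart K η x - highPart K η y‖ₑ := by
  have h : K x - K y = ((K x - highPart K η x) - (K y - highPart K η y))
      + (highPart K η x - highPart K η y) := by ring
  rw [h, two_mul]
  refine (enorm_add_le _ _).trans (add_le_add ?_ le_rfl)
  exact enorm_sub_le.trans
    (add_le_add (enorm_sub_highPart_le K hη x) (enorm_sub_highPart_le K hη y))

end HighPart

/-! ### Concentration of dilated convolutions, in measure. -/

section ApproximateIdentity

variable {V 𝕜 : Type*} [NormedAddCommGroup V] [NormedSpace ℝ V] [FiniteDimensional ℝ V]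
  [MeasurableSpace V] [BorelSpace V] {μ : Measure V} [μ.IsAddHaarMeasure] [RCLike 𝕜]

/-- Continuity of translations in `L¹`. -/
lemma tendsto_lintegral_enorm_translate_sub {g : V → 𝕜} (hg : Integrable g μ) :
    Tendsto (fun h : V => ∫⁻ x, ‖g (x - h) - g x‖ₑ ∂μ) (𝓝 0) (𝓝 0) := by
  have hmem : MemLp g 1 μ := memLp_one_iff_integrable.2 hg
  have : Fact ((1 : ℝ≥0∞) ≠ ∞) := ⟨ENNReal.one_ne_top⟩
  -- `DomAddAct.mk a` acts by `g ↦ g (a + ·)`, hence the sign in `-h` below.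
  let F : Lp 𝕜 1 μ := hmem.toLp g
  have hc : Continuous fun h : V => DomAddAct.mk (-h) +ᵥ F :=
    (DomAddAct.continuous_mk.comp continuous_neg).vadd continuous_const
  have ht := (hc.edist (continuous_const (y := F))).tendsto 0
  simp only [neg_zero] at ht
  have h0 : edist (DomAddAct.mk (0 : V) +ᵥ F) F = 0 := by
    rw [show DomAddAct.mk (0 : V) = 0 from rfl, zero_vadd, edist_self]
  rw [h0] at ht
  refine ht.congr fun h => ?_
  rw [DomAddAct.mk_vadd_toLp, Lp.edist_toLp_toLp, eLpNorm_one_eq_lintegral_enorm]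
  refine lintegral_congr fun x => ?_
  simp only [Pi.sub_apply, vadd_eq_add, sub_eq_neg_add]

omit [NormedSpace ℝ V] [FiniteDimensional ℝ V] in
lemma lintegral_enorm_translate_sub_le {g : V → 𝕜} (hg : AEStronglyMeasurable g μ) (h : V) :
    ∫⁻ x, ‖g (x - h) - g x‖ₑ ∂μ ≤ 2 * ∫⁻ x, ‖g x‖ₑ ∂μ := by
  calc ∫⁻ x, ‖g (x - h) - g x‖ₑ ∂μ ≤ ∫⁻ x, (‖g (x - h)‖ₑ + ‖g x‖ₑ) ∂μ :=
        lintegral_mono fun x => enorm_sub_le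
    _ = ∫⁻ x, ‖g (x - h)‖ₑ ∂μ + ∫⁻ x, ‖g x‖ₑ ∂μ := lintegral_add_right' _ hg.enorm
    _ = 2 * ∫⁻ x, ‖g x‖ₑ ∂μ := by
        rw [lintegral_sub_right_eq_self (fun x => ‖g x‖ₑ) h, two_mul]

/-- For fixed second coordinate the map is a translation, so `ε = 0` is allowed. Pulling null sets
back to null sets is what lets an a.e. measurable `g` be composed with it. -/
lemma quasiMeasurePreserving_sub_smul (ε : ℝ) :
    Measure.QuasiMeasurePreserving (fun p : V × V => p.1 - ε • p.2) (μ.prod μ) μ :=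
  QuasiMeasurePreserving.prod_of_left (by fun_prop) (Eventually.of_forall fun y =>
    (measurePreserving_sub_right μ (ε • y)).quasiMeasurePreserving)

lemma quasiMeasurePreserving_const_sub_smul {ε : ℝ} (hε : ε ≠ 0) (u : V) :
    Measure.QuasiMeasurePreserving (fun y : V => u - ε • y) μ μ :=
  (quasiMeasurePreserving_sub_left μ u).comp (Measure.quasiMeasurePreserving_smul μ hε)

/-- The averaged translation error of `g` against `f` at scale `ε`. -/
noncomputable def translationError (μ : Measure V) (g : V → 𝕜) (f : V → ℝ) (ε : ℝ) (u : V) : ℝ≥0∞ :=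
  ∫⁻ y, ‖g (u - ε • y) - g u‖ₑ * ‖f y‖ₑ ∂μ

lemma aemeasurable_translationError_integrand {g : V → 𝕜} (hg : AEStronglyMeasurable g μ)
    {f : V → ℝ} (hf : AEStronglyMeasurable f μ) (ε : ℝ) :
    AEMeasurable (fun p : V × V => ‖g (p.1 - ε • p.2) - g p.1‖ₑ * ‖f p.2‖ₑ) (μ.prod μ) :=
  ((hg.comp_quasiMeasurePreserving (quasiMeasurePreserving_sub_smul ε)).sub
    hg.comp_fst).enorm.mul hf.comp_snd.enorm

lemma aemeasurable_translationError {g : V → 𝕜} (hg : AEStronglyMeasurable g μ)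
    {f : V → ℝ} (hf : AEStronglyMeasurable f μ) (ε : ℝ) :
    AEMeasurable (translationError μ g f ε) μ :=
  (aemeasurable_translationError_integrand hg hf ε).lintegral_prod_right'

lemma lintegral_translationError {g : V → 𝕜} (hg : AEStronglyMeasurable g μ)
    {f : V → ℝ} (hf : AEStronglyMeasurable f μ) (ε : ℝ) :
    ∫⁻ u, translationError μ g f ε u ∂μ =
      ∫⁻ y, (∫⁻ u, ‖g (u - ε • y) - g u‖ₑ ∂μ) * ‖f y‖ₑ ∂μ := by
  unfold translationError
  rw [lintegral_lintegral_swap (aemeasurable_translationError_integrand hg hf ε)]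
  refine lintegral_congr fun y => ?_
  rw [lintegral_mul_const'' _ ]
  exact ((hg.comp_quasiMeasurePreserving
    (measurePreserving_sub_right μ (ε • y)).quasiMeasurePreserving).sub hg).enorm

lemma lintegral_translationError_ne_top {g : V → 𝕜} (hg : Integrable g μ)
    {f : V → ℝ} (hf : Integrable f μ) (ε : ℝ) :
    ∫⁻ u, translationError μ g f ε u ∂μ ≠ ∞ := by
  rw [lintegral_translationError hg.1 hf.1]
  refine ne_top_of_le_ne_top ?_ (lintegral_mono fun y =>
    mul_le_mul_left (lintegral_enorm_translate_sub_le hg.1 (ε • y)) ‖f y‖ₑ)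
  rw [lintegral_const_mul'' _ hf.1.enorm]
  exact ENNReal.mul_ne_top (ENNReal.mul_ne_top (by simp) hg.2.ne) hf.2.ne

lemma tendsto_lintegral_translationError {g : V → 𝕜} (hg : Integrable g μ)
    {f : V → ℝ} (hf : Integrable f μ) :
    Tendsto (fun ε : ℝ => ∫⁻ u, translationError μ g f ε u ∂μ) (𝓝 0) (𝓝 0) := by
  simp only [lintegral_translationError hg.1 hf.1]
  -- Dominated convergence is applied along sequences, with dominating function `2 ‖g‖₁ |f|`.
  refine tendsto_of_seq_tendsto fun ε hε => ?_
  rw [show (0 : ℝ≥0∞) = ∫⁻ y, 0 ∂μ by simp]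
  refine tendsto_lintegral_of_dominated_convergence'
    (fun y => 2 * (∫⁻ x, ‖g x‖ₑ ∂μ) * ‖f y‖ₑ) (fun k => ?_)
    (fun k => Eventually.of_forall fun y =>
      mul_le_mul_left (lintegral_enorm_translate_sub_le hg.1 (ε k • y)) ‖f y‖ₑ) ?_
    (Eventually.of_forall fun y => ?_)
  · refine AEMeasurable.mul ?_ hf.1.enorm
    have h := ((hg.1.comp_quasiMeasurePreserving
      (quasiMeasurePreserving_sub_smul (μ := μ) (ε k))).sub hg.1.comp_fst).enorm.prod_swap
    exact h.lintegral_prod_right'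
  · rw [lintegral_const_mul'' _ hf.1.enorm]
    exact ENNReal.mul_ne_top (ENNReal.mul_ne_top (by simp) hg.2.ne) hf.2.ne
  · have h1 : Tendsto (fun ε : ℝ => ε • y) (𝓝 0) (𝓝 0) := by
      have : Continuous fun ε : ℝ => ε • y := by fun_prop
      simpa using this.tendsto 0
    simpa using ENNReal.Tendsto.mul_const
      ((tendsto_lintegral_enorm_translate_sub hg).comp (h1.comp hε)) (b := ‖f y‖ₑ) (Or.inr enorm_ne_top)

omit [FiniteDimensional ℝ V] [BorelSpace V] [μ.IsAddHaarMeasure] in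
lemma translationError_le (K : V → 𝕜) {f : V → ℝ} (hf : AEStronglyMeasurable f μ)
    {η : ℝ} (hη : 0 ≤ η) (ε : ℝ) (u : V) :
    translationError μ K f ε u ≤
      2 * ENNReal.ofReal η * ∫⁻ y, ‖f y‖ₑ ∂μ + translationError μ (highPart K η) f ε u := by
  unfold translationError
  rw [← lintegral_const_mul'' _ hf.enorm, ← lintegral_add_left' (hf.enorm.const_mul _)]
  refine lintegral_mono fun y => ?_
  rw [← add_mul]
  exact mul_le_mul_left (enorm_sub_le_add_highPart K hη _ _) ‖f y‖ₑ

variable {K : V → 𝕜} {f : V → ℝ}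

/-- A single cut, here at height `1`, suffices: the low part costs a finite constant, and the high
part has a finite integral in `u`. -/
lemma ae_translationError_ne_top (hK : ∀ η > 0, Integrable (highPart K η) μ)
    (hf : Integrable f μ) (ε : ℝ) : ∀ᵐ u ∂μ, translationError μ K f ε u ≠ ∞ := by
  have h1 := hK 1 one_pos
  filter_upwards [ae_lt_top' (aemeasurable_translationError h1.1 hf.1 ε)
    (lintegral_translationError_ne_top h1 hf ε)] with u hu
  refine ne_top_of_le_ne_top ?_ (translationError_le K hf.1 zero_le_one ε u)
  exact ENNReal.add_ne_top.2 ⟨ENNReal.mul_ne_top (by simp) hf.2.ne, hu.ne⟩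

lemma integrable_sub_mul_of_translationError_ne_top (hKm : AEStronglyMeasurable K μ)
    (hf : Integrable f μ) {ε : ℝ} (hε : ε ≠ 0) {u : V} (hu : translationError μ K f ε u ≠ ∞) :
    Integrable (fun y => (K (u - ε • y) - K u) * (f y : 𝕜)) μ := by
  refine ⟨((hKm.comp_quasiMeasurePreserving (quasiMeasurePreserving_const_sub_smul hε u)).sub
    aestronglyMeasurable_const).mul hf.ofReal.1, ?_⟩
  refine lt_of_eq_of_lt (lintegral_congr fun y => ?_) hu.lt_top
  rw [enorm_mul]
  congr 1
  rw [← ofReal_norm, ← ofReal_norm, RCLike.norm_ofReal, Real.norm_eq_abs]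

/-- Absolute convergence of the rescaled convolution. -/
lemma ae_integrable_dilated_convolution (hKm : AEStronglyMeasurable K μ)
    (hK : ∀ η > 0, Integrable (highPart K η) μ) (hf : Integrable f μ) {ε : ℝ} (hε : ε ≠ 0) :
    ∀ᵐ u ∂μ, Integrable (fun y => K (u - ε • y) * (f y : 𝕜)) μ := by
  filter_upwards [ae_translationError_ne_top hK hf ε] with u hu
  have h := (integrable_sub_mul_of_translationError_ne_top hKm hf hε hu).add
    (hf.ofReal.const_mul (K u))
  refine h.congr (Eventually.of_forall fun y => ?_)
  simp only [Pi.add_apply]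
  ring

lemma ae_enorm_dilated_convolution_sub_le (hKm : AEStronglyMeasurable K μ)
    (hK : ∀ η > 0, Integrable (highPart K η) μ) (hf : Integrable f μ) {ε : ℝ} (hε : ε ≠ 0) :
    ∀ᵐ u ∂μ, ‖∫ y, K (u - ε • y) * (f y : 𝕜) ∂μ - K u * ∫ y, (f y : 𝕜) ∂μ‖ₑ ≤
      translationError μ K f ε u := by
  filter_upwards [ae_integrable_dilated_convolution hKm hK hf hε] with u hu
  rw [← integral_const_mul, ← integral_sub hu (hf.ofReal.const_mul (K u))]
  refine (enorm_integral_le_lintegral_enorm _).trans (lintegral_mono fun y => ?_)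
  rw [← sub_mul, enorm_mul]
  refine mul_le_mul_right (le_of_eq ?_) _
  rw [← ofReal_norm, ← ofReal_norm, RCLike.norm_ofReal, Real.norm_eq_abs]

/-- The dilated convolutions converge in measure to a multiple of the kernel. -/
lemma tendsto_measure_dilated_convolution_sub (hKm : AEStronglyMeasurable K μ)
    (hK : ∀ η > 0, Integrable (highPart K η) μ) (hf : Integrable f μ) {δ : ℝ} (hδ : 0 < δ) :
    Tendsto (fun ε : ℝ => μ {u | δ <
      ‖∫ y, K (u - ε • y) * (f y : 𝕜) ∂μ - K u * ∫ y, (f y : 𝕜) ∂μ‖}) (𝓝[>] 0) (𝓝 0) := by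
  set M : ℝ := ∫ y, ‖f y‖ ∂μ with hM
  have hM0 : 0 ≤ M := integral_nonneg fun _ => norm_nonneg _
  have hMf : ∫⁻ y, ‖f y‖ₑ ∂μ = ENNReal.ofReal M := by
    rw [hM, ofReal_integral_norm_eq_lintegral_enorm hf]
  -- Chosen so that the low part costs `2 η M ≤ δ / 2`; the `+ 1` covers `M = 0`.
  set η : ℝ := δ / (4 * (M + 1)) with hηdef
  have hη : 0 < η := by positivity
  have hηM : 2 * η * M ≤ δ / 2 := by
    rw [hηdef]; field_simp; linarith
  have hδ2 : ENNReal.ofReal (δ / 2) ≠ 0 := by simpa using hδ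
  have key : ∀ ε : ℝ, ε ≠ 0 → μ {u | δ <
      ‖∫ y, K (u - ε • y) * (f y : 𝕜) ∂μ - K u * ∫ y, (f y : 𝕜) ∂μ‖} ≤
      (∫⁻ u, translationError μ (highPart K η) f ε u ∂μ) / ENNReal.ofReal (δ / 2) := by
    -- Where the difference exceeds `δ`, the low part explains at most `δ / 2`, so the high-part
    -- error is at least `δ / 2` and Markov applies.
    intro ε hε
    refine le_trans (measure_mono_ae ?_) (meas_ge_le_lintegral_div
      (aemeasurable_translationError (hK η hη).1 hf.1 ε) hδ2 ENNReal.ofReal_ne_top)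
    filter_upwards [ae_enorm_dilated_convolution_sub_le hKm hK hf hε] with u hu hu'
    have h1 := hu.trans (translationError_le K hf.1 hη.le ε u)
    have h2 : ENNReal.ofReal δ ≤ _ := (ENNReal.ofReal_le_ofReal (le_of_lt hu')).trans
      ((ofReal_norm _).le.trans h1)
    have h3 : 2 * ENNReal.ofReal η * ∫⁻ y, ‖f y‖ₑ ∂μ ≤ ENNReal.ofReal (δ / 2) := by
      rw [hMf, show (2 : ℝ≥0∞) = ENNReal.ofReal 2 by simp, ← ENNReal.ofReal_mul (by norm_num),
        ← ENNReal.ofReal_mul (by positivity)]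
      exact ENNReal.ofReal_le_ofReal hηM
    have h4 : ENNReal.ofReal δ = ENNReal.ofReal (δ / 2) + ENNReal.ofReal (δ / 2) := by
      rw [← ENNReal.ofReal_add (by positivity) (by positivity), add_halves]
    rw [h4] at h2
    exact (ENNReal.add_le_add_iff_left ENNReal.ofReal_ne_top).1
      (h2.trans (add_le_add_left h3 _))
  have hlim : Tendsto (fun ε : ℝ => (∫⁻ u, translationError μ (highPart K η) f ε u ∂μ) /
      ENNReal.ofReal (δ / 2)) (𝓝[>] 0) (𝓝 0) := by
    simpa using ENNReal.Tendsto.div_const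
      ((tendsto_lintegral_translationError (hK η hη) hf).mono_left nhdsWithin_le_nhds)
      (b := ENNReal.ofReal (δ / 2)) (Or.inr hδ2)
  refine tendsto_of_tendsto_of_tendsto_of_le_of_le' tendsto_const_nhds hlim
    (Eventually.of_forall fun _ => zero_le) ?_
  filter_upwards [self_mem_nhdsWithin] with ε hε
  exact key ε (ne_of_gt hε)

end ApproximateIdentity

/-! ### From convergence in measure to distribution functions. -/

/-- Convergence in measure implies convergence of the distribution function at its continuity
points. -/
lemma tendsto_measure_lt_norm_of_tendsto_measure_sub {X ι F : Type*} [MeasurableSpace X]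
    {μ : Measure X} [SeminormedAddCommGroup F] {l : Filter ι} {G : ι → X → F} {g : X → F} {s : ℝ}
    (hG : ∀ δ : ℝ, 0 < δ → Tendsto (fun i => μ {x | δ < ‖G i x - g x‖}) l (𝓝 0))
    (hg : ContinuousAt (fun t : ℝ => μ {x | t < ‖g x‖}) s) :
    Tendsto (fun i => μ {x | s < ‖G i x‖}) l (𝓝 (μ {x | s < ‖g x‖})) := by
  have hup : Tendsto (fun δ : ℝ => μ {x | s + δ < ‖g x‖}) (𝓝[>] 0) (𝓝 (μ {x | s < ‖g x‖})) := by
    refine hg.tendsto.comp (tendsto_nhdsWithin_of_tendsto_nhds ?_)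
    exact Continuous.tendsto' (by fun_prop) _ _ (by simp)
  have hdown : Tendsto (fun δ : ℝ => μ {x | s - δ < ‖g x‖}) (𝓝[>] 0)
      (𝓝 (μ {x | s < ‖g x‖})) := by
    refine hg.tendsto.comp (tendsto_nhdsWithin_of_tendsto_nhds ?_)
    exact Continuous.tendsto' (by fun_prop) _ _ (by simp)
  refine tendsto_order.2 ⟨fun a ha => ?_, fun a ha => ?_⟩
  -- Continuity at `s` lets the level move to `s + δ` while the measure stays above `a`; the slack
  -- `b` absorbs the exceptional set.
  · obtain ⟨δ, hδa, hδ⟩ := ((hup.eventually (lt_mem_nhds ha)).and self_mem_nhdsWithin).exists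
    have hδ' : 0 < δ := hδ
    obtain ⟨b, hb, hab⟩ := ENNReal.lt_iff_exists_add_pos_lt.1 hδa
    filter_upwards [(hG δ hδ').eventually (gt_mem_nhds (ENNReal.coe_pos.2 hb))] with i hi
    by_contra! hcon
    have h1 : μ {x | s + δ < ‖g x‖} ≤ μ {x | s < ‖G i x‖} + μ {x | δ < ‖G i x - g x‖} := by
      refine (measure_mono fun x hx => ?_).trans (measure_union_le _ _)
      by_contra! hx'
      simp only [Set.mem_union, Set.mem_ofPred_eq, not_or, not_lt] at hx hx'
      have := norm_sub_norm_le (g x) (G i x)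
      rw [norm_sub_rev] at this
      linarith
    exact absurd (h1.trans (add_le_add hcon hi.le)) (not_le.2 hab)
  · obtain ⟨δ, hδa, hδ⟩ := ((hdown.eventually (gt_mem_nhds ha)).and self_mem_nhdsWithin).exists
    have hδ' : 0 < δ := hδ
    obtain ⟨b, hb, hab⟩ := ENNReal.lt_iff_exists_add_pos_lt.1 hδa
    filter_upwards [(hG δ hδ').eventually (gt_mem_nhds (ENNReal.coe_pos.2 hb))] with i hi
    have h1 : μ {x | s < ‖G i x‖} ≤ μ {x | s - δ < ‖g x‖} + μ {x | δ < ‖G i x - g x‖} := by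
      refine (measure_mono fun x hx => ?_).trans (measure_union_le _ _)
      by_contra! hx'
      simp only [Set.mem_union, Set.mem_ofPred_eq, not_or, not_lt] at hx hx'
      have := norm_sub_norm_le (G i x) (g x)
      linarith
    exact (h1.trans (add_le_add le_rfl hi.le)).trans_lt hab

/-! ### The kernel in polar coordinates. -/

section Polar

variable {𝕜 : Type*} [RCLike 𝕜] {n : ℕ}

/-- The convolution kernel `Ω(z) |z|^{-(n-α)}`. -/
noncomputable def kernel (Ω : E n → 𝕜) (α : ℝ) (z : E n) : 𝕜 :=
  Ω z / ((‖z‖ ^ ((n : ℝ) - α) : ℝ) : 𝕜)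

lemma integrand_eq (Ω : E n → 𝕜) (α : ℝ) (f : E n → ℝ) (x y : E n) :
    integrand Ω α f x y = kernel Ω α (x - y) * (f y : 𝕜) := rfl

lemma kernel_smul {Ω : E n → 𝕜} (hΩ : HomogeneousDegreeZero Ω) (α : ℝ) {c : ℝ} (hc : 0 < c)
    {z : E n} (hz : z ≠ 0) :
    kernel Ω α (c • z) = kernel Ω α z / ((c ^ ((n : ℝ) - α) : ℝ) : 𝕜) := by
  rw [kernel, kernel, hΩ c hc z hz, norm_smul, Real.norm_of_nonneg hc.le,
    Real.mul_rpow hc.le (norm_nonneg _), RCLike.ofReal_mul, div_div, mul_comm]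

lemma kernel_polar {Ω : E n → 𝕜} (hΩ : HomogeneousDegreeZero Ω) (α : ℝ)
    (p : S n × Set.Ioi (0 : ℝ)) :
    kernel Ω α ((p.2 : ℝ) • (p.1 : E n)) =
      Ω p.1 / (((p.2 : ℝ) ^ ((n : ℝ) - α) : ℝ) : 𝕜) := by
  have h1 : ‖(p.1 : E n)‖ = 1 := by simp
  rw [kernel_smul hΩ α p.2.2 (by intro h; rw [h, norm_zero] at h1; exact zero_ne_one h1),
    kernel, h1, Real.one_rpow, RCLike.ofReal_one, div_one]

lemma measurePreserving_polar (hn : 0 < n) :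
    MeasurePreserving (fun p : S n × Set.Ioi (0 : ℝ) => (p.2 : ℝ) • (p.1 : E n))
      ((area n).prod (Measure.volumeIoiPow (n - 1))) volume := by
  have : Nonempty (Fin n) := ⟨⟨0, hn⟩⟩
  have h1 := (volume : Measure (E n)).measurePreserving_homeomorphUnitSphereProd
  rw [finrank_euclideanSpace_fin] at h1
  have h2 : MeasurePreserving (homeomorphUnitSphereProd (E n)).toMeasurableEquiv.symm _ _ :=
    MeasurePreserving.symm (homeomorphUnitSphereProd (E n)).toMeasurableEquiv h1
  have h3 : MeasurePreserving (Subtype.val : ({0}ᶜ : Set (E n)) → E n)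
      (Measure.comap Subtype.val volume) volume := by
    refine ⟨measurable_subtype_coe, ?_⟩
    rw [map_comap_subtype_coe (measurableSet_singleton _).compl, restrict_compl_singleton]
  exact h3.comp h2

lemma measurableEmbedding_polar :
    MeasurableEmbedding (fun p : S n × Set.Ioi (0 : ℝ) => (p.2 : ℝ) • (p.1 : E n)) :=
  (MeasurableEmbedding.subtype_coe (measurableSet_singleton (0 : E n)).compl).comp
    (homeomorphUnitSphereProd (E n)).symm.measurableEmbedding

lemma aestronglyMeasurable_kernel_polar {Ω : E n → 𝕜}
    (hm : AEStronglyMeasurable (fun θ : S n => Ω (θ : E n)) (area n)) (β : ℝ) :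
    AEStronglyMeasurable
      (fun p : S n × Set.Ioi (0 : ℝ) => Ω p.1 / (((p.2 : ℝ) ^ β : ℝ) : 𝕜))
      ((area n).prod (Measure.volumeIoiPow (n - 1))) := by
  have h2 : Measurable fun p : S n × Set.Ioi (0 : ℝ) => (((p.2 : ℝ) ^ β : ℝ) : 𝕜)⁻¹ :=
    (RCLike.measurable_ofReal.comp
      ((measurable_subtype_coe.comp measurable_snd).pow_const β)).inv
  simp only [div_eq_mul_inv]
  exact hm.comp_fst.mul h2.aestronglyMeasurable

/-- The polar map is a measurable embedding carrying the product measure to `volume`, so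
measurability of `Ω` on the sphere is enough. -/
lemma aestronglyMeasurable_kernel (hn : 0 < n) {Ω : E n → 𝕜} (hΩ : HomogeneousDegreeZero Ω)
    (hm : AEStronglyMeasurable (fun θ : S n => Ω (θ : E n)) (area n)) (α : ℝ) :
    AEStronglyMeasurable (kernel Ω α) volume := by
  rw [← (measurePreserving_polar hn).map_eq, measurableEmbedding_polar.aestronglyMeasurable_map_iff]
  refine (aestronglyMeasurable_kernel_polar hm ((n : ℝ) - α)).congr
    (Eventually.of_forall fun p => ?_)
  exact (kernel_polar hΩ α p).symm

/-- Radial measure of the superlevel set `{s > 0 : a / s ^ β > t}`. -/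
lemma volumeIoiPow_setOf_lt (hn : 0 < n) {a t β : ℝ} (ha : 0 ≤ a) (ht : 0 < t) (hβ : 0 < β) :
    Measure.volumeIoiPow (n - 1) {s : Set.Ioi (0 : ℝ) | t < a / (s : ℝ) ^ β} =
      ENNReal.ofReal (t ^ (-(n / β))) * (n : ℝ≥0∞)⁻¹ * ENNReal.ofReal a ^ (n / β) := by
  have hnR : (0 : ℝ) < n := Nat.cast_pos.2 hn
  have hr : 0 < n / β := div_pos hnR hβ
  -- For `a = 0` the critical radius is `0`, which is not a point of `Set.Ioi 0`.
  rcases ha.eq_or_lt with rfl | ha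
  · have : {s : Set.Ioi (0 : ℝ) | t < 0 / (s : ℝ) ^ β} = ∅ := by
      ext s
      simp [ht.le]
    rw [this, measure_empty, ENNReal.ofReal_zero, ENNReal.zero_rpow_of_pos hr, mul_zero]
  · have hat : 0 < a / t := div_pos ha ht
    have hx : 0 < (a / t) ^ β⁻¹ := Real.rpow_pos_of_pos hat _
    have hset : {s : Set.Ioi (0 : ℝ) | t < a / (s : ℝ) ^ β} =
        Set.Iio (⟨(a / t) ^ β⁻¹, hx⟩ : Set.Ioi (0 : ℝ)) := by
      ext s
      have hs : (0 : ℝ) < s := s.2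
      rw [Set.mem_ofPred_eq, Set.mem_Iio, ← Subtype.coe_lt_coe, Real.lt_rpow_inv_iff_of_pos hs.le
        hat.le hβ, lt_div_iff₀ (Real.rpow_pos_of_pos hs _), lt_div_iff₀ ht, mul_comm]
    have hcast : ((n - 1 : ℕ) : ℝ) + 1 = n := by
      rw [Nat.cast_pred hn]; ring
    rw [hset, Measure.volumeIoiPow_apply_Iio, Nat.sub_add_cancel hn, hcast]
    have hpow : ((a / t) ^ β⁻¹) ^ n / (n : ℝ) = t ^ (-(n / β)) * (n : ℝ)⁻¹ * a ^ (n / β) := by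
      rw [← Real.rpow_natCast, ← Real.rpow_mul hat.le, Real.div_rpow ha.le ht.le,
        Real.rpow_neg ht.le, inv_mul_eq_div]
      ring
    rw [hpow, ENNReal.ofReal_mul (by positivity), ENNReal.ofReal_mul (by positivity),
      ENNReal.ofReal_rpow_of_pos ha, ENNReal.ofReal_inv_of_pos hnR, ENNReal.ofReal_natCast]

/-- The distribution function of the kernel. -/
lemma volume_lt_norm_kernel {α r : ℝ} (hα : 0 < α) (hαn : α < n) (hr : r = n / (n - α))
    {Ω : E n → 𝕜} (hΩ : HomogeneousDegreeZero Ω)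
    (hm : AEStronglyMeasurable (fun θ : S n => Ω (θ : E n)) (area n)) {t : ℝ} (ht : 0 < t) :
    volume {z : E n | t < ‖kernel Ω α z‖} = ENNReal.ofReal (t ^ (-r)) *
      ((n : ℝ≥0∞)⁻¹ *
        eLpNorm (fun θ : S n => Ω (θ : E n)) (ENNReal.ofReal r) (area n) ^ r) := by
  have hnR : (0 : ℝ) < n := hα.trans hαn
  have hn : 0 < n := Nat.cast_pos.1 hnR
  have hβ : 0 < (n : ℝ) - α := sub_pos.2 hαn
  have hr0 : 0 < r := hr ▸ div_pos hnR hβ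
  have hN : eLpNorm (fun θ : S n => Ω (θ : E n)) (ENNReal.ofReal r) (area n) ^ r =
      ∫⁻ θ : S n, ‖Ω (θ : E n)‖ₑ ^ r ∂(area n) := by
    rw [eLpNorm_eq_lintegral_rpow_enorm_toReal (by simpa using hr0) ENNReal.ofReal_ne_top,
      ENNReal.toReal_ofReal hr0.le, ← ENNReal.rpow_mul, one_div_mul_cancel hr0.ne',
      ENNReal.rpow_one]
  have hK := aestronglyMeasurable_kernel_polar hm ((n : ℝ) - α)
  have hnull : NullMeasurableSet {p : S n × Set.Ioi (0 : ℝ) |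
      t < ‖Ω p.1 / (((p.2 : ℝ) ^ ((n : ℝ) - α) : ℝ) : 𝕜)‖}
      ((area n).prod (Measure.volumeIoiPow (n - 1))) :=
    nullMeasurableSet_lt aemeasurable_const hK.norm.aemeasurable
  rw [← (measurePreserving_polar hn).measure_preimage_emb measurableEmbedding_polar, hN]
  simp only [Set.preimage_ofPred_eq, kernel_polar hΩ α]
  -- The set is only null measurable, so Tonelli is applied to its indicator.
  have hone := lintegral_indicator_const₀ hnull 1
  rw [one_mul] at hone
  rw [← hone, lintegral_prod _ ((aemeasurable_indicator_const_iff 1).2 hnull), ← mul_assoc,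
    ← lintegral_const_mul'' _ (hm.enorm.pow_const r)]
  refine lintegral_congr fun θ => ?_
  have hmeas : MeasurableSet {s : Set.Ioi (0 : ℝ) | t < ‖Ω (θ : E n)‖ / (s : ℝ) ^ ((n : ℝ) - α)} :=
    measurableSet_lt measurable_const
      (measurable_const.div (measurable_subtype_coe.pow_const _))
  have hθ := volumeIoiPow_setOf_lt hn (norm_nonneg (Ω (θ : E n))) ht hβ
  rw [← hr, ofReal_norm] at hθ
  rw [← hθ, ← one_mul (Measure.volumeIoiPow _ _), ← lintegral_indicator_const hmeas]
  refine lintegral_congr fun s => ?_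
  have hs : 0 ≤ (s : ℝ) ^ ((n : ℝ) - α) := Real.rpow_nonneg s.2.out.le _
  simp only [Set.indicator, Set.mem_ofPred_eq, norm_div, RCLike.norm_ofReal, abs_of_nonneg hs]

/-- Layer cake: levels below `η` see only `{η < ‖K‖}`, of finite measure, and above `η` the
distribution function `A t ^ (-r)` is integrable since `r > 1`. -/
lemma integrable_highPart_kernel {α r : ℝ} (hα : 0 < α) (hαn : α < n) (hr : r = n / (n - α))
    {Ω : E n → 𝕜} (hΩ : HomogeneousDegreeZero Ω)
    (hm : MemLp (fun θ : S n => Ω (θ : E n)) (ENNReal.ofReal r) (area n)) {η : ℝ} (hη : 0 < η) :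
    Integrable (highPart (kernel Ω α) η) volume := by
  have hnR : (0 : ℝ) < n := hα.trans hαn
  have hn : 0 < n := Nat.cast_pos.1 hnR
  have hβ : 0 < (n : ℝ) - α := sub_pos.2 hαn
  have hr1 : 1 < r := by rw [hr, one_lt_div hβ]; linarith
  set A : ℝ≥0∞ := (n : ℝ≥0∞)⁻¹ *
    eLpNorm (fun θ : S n => Ω (θ : E n)) (ENNReal.ofReal r) (area n) ^ r with hA
  have hAtop : A ≠ ∞ := ENNReal.mul_ne_top (by simp [hn.ne'])
    (ENNReal.rpow_ne_top_of_nonneg (by linarith) hm.2.ne)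
  have hd := fun {t : ℝ} (ht : 0 < t) => volume_lt_norm_kernel hα hαn hr hΩ hm.1 ht
  have hK := aestronglyMeasurable_kernel hn hΩ hm.1 α
  have hmeas : AEStronglyMeasurable (highPart (kernel Ω α) η) volume :=
    hK.indicator₀ (nullMeasurableSet_lt aemeasurable_const hK.norm.aemeasurable)
  have hnorm : ∀ (t : ℝ), 0 < t → {z : E n | t < ‖highPart (kernel Ω α) η z‖} ⊆
      {z : E n | max η t < ‖kernel Ω α z‖} := by
    intro t ht z hz
    by_cases h : η < ‖kernel Ω α z‖
    · rw [Set.mem_ofPred_eq, highPart,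
        Set.indicator_of_mem (show z ∈ {x | η < ‖kernel Ω α x‖} from h)] at hz
      exact max_lt h hz
    · rw [Set.mem_ofPred_eq, highPart,
        Set.indicator_of_notMem (show z ∉ {x | η < ‖kernel Ω α x‖} from h), norm_zero] at hz
      exact absurd hz ht.le.not_gt
  refine ⟨hmeas, ?_⟩
  rw [hasFiniteIntegral_iff_norm, lintegral_eq_lintegral_meas_lt _
    (Eventually.of_forall fun _ => norm_nonneg _) hmeas.norm.aemeasurable,
    ← Set.Ioc_union_Ioi_eq_Ioi hη.le]
  refine lt_of_le_of_lt (lintegral_union_le _ _ _) (ENNReal.add_lt_top.2 ⟨?_, ?_⟩)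
  · refine lt_of_le_of_lt (setLIntegral_mono (g := fun _ => ENNReal.ofReal (η ^ (-r)) * A)
      measurable_const fun t ht => ?_) ?_
    · rw [← hd hη]
      exact measure_mono fun z hz => (le_max_left η t).trans_lt (hnorm t ht.1 hz)
    · rw [setLIntegral_const]
      exact ENNReal.mul_lt_top (ENNReal.mul_lt_top ENNReal.ofReal_lt_top hAtop.lt_top) (by simp)
  · refine lt_of_le_of_lt (setLIntegral_mono (g := fun t => ENNReal.ofReal (t ^ (-r)) * A)
      (by fun_prop) fun t ht => ?_) ?_
    · have ht0 : 0 < t := hη.trans ht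
      rw [← hd ht0]
      exact measure_mono fun z hz => (le_max_right η t).trans_lt (hnorm t ht0 hz)
    · rw [lintegral_mul_const _ (by fun_prop)]
      refine ENNReal.mul_lt_top ?_ hAtop.lt_top
      have := (integrableOn_Ioi_rpow_of_lt (show -r < -1 by linarith) hη).2
      refine lt_of_le_of_lt (lintegral_mono fun t => ?_) this
      exact Real.ofReal_le_enorm _

end Polar

/-! ### Rescaling and the limit. -/

section Main

variable {𝕜 : Type*} [RCLike 𝕜] {n : ℕ}

lemma fractionalIntegral_inv_smul {Ω : E n → 𝕜} (hΩ : HomogeneousDegreeZero Ω) (α : ℝ)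
    (f : E n → ℝ) (hn : 0 < n) {ε : ℝ} (hε : 0 < ε) (u : E n) :
    fractionalIntegral Ω α f (ε⁻¹ • u) =
      ((ε ^ ((n : ℝ) - α) : ℝ) : 𝕜) * ∫ y, kernel Ω α (u - ε • y) * (f y : 𝕜) := by
  have : Nonempty (Fin n) := ⟨⟨0, hn⟩⟩
  rw [fractionalIntegral, ← integral_const_mul]
  refine integral_congr_ae ?_
  -- Homogeneity fails at the origin, so the one point where `u - ε • y = 0` is discarded.
  have hne : ∀ᵐ y : E n, y ≠ ε⁻¹ • u := by
    simp [ae_iff]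
  filter_upwards [hne] with y hy
  have hz : u - ε • y ≠ 0 := by
    intro h
    rw [sub_eq_zero] at h
    exact hy (by rw [h, inv_smul_smul₀ hε.ne'])
  have h1 : ε⁻¹ • u - y = ε⁻¹ • (u - ε • y) := by
    rw [smul_sub, inv_smul_smul₀ hε.ne']
  rw [integrand_eq, h1, kernel_smul hΩ α (inv_pos.2 hε) hz, Real.inv_rpow hε.le,
    RCLike.ofReal_inv, div_inv_eq_mul]
  ring

/-- Rescaling of the distribution function of the fractional integral. -/
lemma volume_lt_norm_fractionalIntegral {α r : ℝ} (hα : 0 < α) (hαn : α < n)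
    (hr : r = n / (n - α)) {Ω : E n → 𝕜} (hΩ : HomogeneousDegreeZero Ω) (f : E n → ℝ)
    {t : ℝ} (ht : 0 < t) :
    ENNReal.ofReal (t ^ r) * volume {x : E n | t < ‖fractionalIntegral Ω α f x‖} =
      volume {u : E n |
        1 < ‖∫ y, kernel Ω α (u - t ^ ((n : ℝ) - α)⁻¹ • y) * (f y : 𝕜)‖} := by
  have hnR : (0 : ℝ) < n := hα.trans hαn
  have hn : 0 < n := Nat.cast_pos.1 hnR
  have hβ : 0 < (n : ℝ) - α := sub_pos.2 hαn
  set ε : ℝ := t ^ ((n : ℝ) - α)⁻¹ with hεdef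
  have hε : 0 < ε := Real.rpow_pos_of_pos ht _
  have hεβ : ε ^ ((n : ℝ) - α) = t := Real.rpow_inv_rpow ht.le hβ.ne'
  have hεn : ε ^ n = t ^ r := by
    rw [hεdef, ← Real.rpow_natCast, ← Real.rpow_mul ht.le, hr, inv_mul_eq_div]
  have hset : {u : E n | 1 < ‖∫ y, kernel Ω α (u - ε • y) * (f y : 𝕜)‖} =
      (ε⁻¹ • ·) ⁻¹' {x : E n | t < ‖fractionalIntegral Ω α f x‖} := by
    ext u
    rw [Set.mem_preimage, Set.mem_ofPred_eq, Set.mem_ofPred_eq,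
      fractionalIntegral_inv_smul hΩ α f hn hε, hεβ, norm_mul, RCLike.norm_ofReal,
      abs_of_pos ht, lt_mul_iff_one_lt_right ht]
  rw [hset, Measure.addHaar_preimage_smul _ (inv_ne_zero hε.ne'), finrank_euclideanSpace_fin,
    inv_pow, inv_inv, hεn, abs_of_pos (Real.rpow_pos_of_pos ht _)]

/-- The fractional integral of an integrable function converges absolutely almost everywhere. -/
theorem ae_integrable_integrand {α r : ℝ} (hα : 0 < α) (hαn : α < n) (hr : r = n / (n - α))
    {Ω : E n → 𝕜} (hΩ : HomogeneousDegreeZero Ω)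
    (hm : MemLp (fun θ : S n => Ω (θ : E n)) (ENNReal.ofReal r) (area n))
    {f : E n → ℝ} (hf : Integrable f volume) :
    ∀ᵐ x : E n, Integrable (integrand Ω α f x) volume := by
  have hn : 0 < n := Nat.cast_pos.1 (hα.trans hαn)
  filter_upwards [ae_integrable_dilated_convolution (aestronglyMeasurable_kernel hn hΩ hm.1 α)
    (fun η hη => integrable_highPart_kernel hα hαn hr hΩ hm hη) hf one_ne_zero] with x hx
  simp only [one_smul] at hx
  exact hx

/-- The limiting weak-type behaviour of the fractional integral. -/
theorem tendsto_rpow_mul_volume_lt_norm_fractionalIntegral {α r : ℝ} (hα : 0 < α) (hαn : α < n)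
    (hr : r = n / (n - α)) {Ω : E n → 𝕜} (hΩ : HomogeneousDegreeZero Ω)
    (hm : MemLp (fun θ : S n => Ω (θ : E n)) (ENNReal.ofReal r) (area n))
    {f : E n → ℝ} (hf : Integrable f volume) (hf_nonneg : 0 ≤ᵐ[volume] f) :
    Tendsto (fun t : ℝ => ENNReal.ofReal (t ^ r) *
        volume {x : E n | t < ‖fractionalIntegral Ω α f x‖})
      (𝓝[>] 0)
      (𝓝 ((n : ℝ≥0∞)⁻¹ *
        eLpNorm (fun θ : S n => Ω (θ : E n)) (ENNReal.ofReal r) (area n) ^ r *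
        eLpNorm f 1 volume ^ r)) := by
  have hnR : (0 : ℝ) < n := hα.trans hαn
  have hn : 0 < n := Nat.cast_pos.1 hnR
  have hβ : 0 < (n : ℝ) - α := sub_pos.2 hαn
  have hr0 : 0 < r := hr ▸ div_pos hnR hβ
  have hKm := aestronglyMeasurable_kernel hn hΩ hm.1 α
  have hK : ∀ η > 0, Integrable (highPart (kernel Ω α) η) volume := fun η hη =>
    integrable_highPart_kernel hα hαn hr hΩ hm hη
  set A : ℝ≥0∞ := (n : ℝ≥0∞)⁻¹ *
    eLpNorm (fun θ : S n => Ω (θ : E n)) (ENNReal.ofReal r) (area n) ^ r with hA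
  have hAtop : A ≠ ∞ := ENNReal.mul_ne_top (by simp [hn.ne'])
    (ENNReal.rpow_ne_top_of_nonneg hr0.le hm.2.ne)
  set c : ℝ := ∫ y, f y with hc
  have hc0 : 0 ≤ c := integral_nonneg_of_ae hf_nonneg
  -- Nonnegativity of `f` enters here: the factor `∫ f` in the limit kernel is `‖f‖₁`.
  have hcf : eLpNorm f 1 volume = ENNReal.ofReal c := by
    rw [eLpNorm_one_eq_lintegral_enorm, ← ofReal_integral_norm_eq_lintegral_enorm hf, hc]
    congr 1
    refine integral_congr_ae ?_
    filter_upwards [hf_nonneg] with y hy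
    exact Real.norm_of_nonneg hy
  have hdist : ∀ s : ℝ, 0 < s → volume {z : E n | s < ‖kernel Ω α z * ∫ y, (f y : 𝕜)‖} =
      ENNReal.ofReal (s ^ (-r)) * (A * ENNReal.ofReal c ^ r) := by
    intro s hs
    have hnorm : ∀ z, ‖kernel Ω α z * ∫ y, (f y : 𝕜)‖ = ‖kernel Ω α z‖ * c := fun z => by
      rw [norm_mul, integral_ofReal, RCLike.norm_ofReal, abs_of_nonneg hc0]
    simp only [hnorm]
    -- If `∫ f = 0` the limit kernel vanishes and both sides are `0`, as `r > 0`; otherwise the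
    -- level is divided by `c`.
    rcases hc0.eq_or_lt with h0 | hcpos
    · rw [← h0]
      simp [hr0, hs.not_gt]
    · simp only [← div_lt_iff₀ hcpos]
      rw [volume_lt_norm_kernel hα hαn hr hΩ hm.1 (div_pos hs hcpos), ← hA,
        Real.div_rpow hs.le hcpos.le, Real.rpow_neg hcpos.le, div_inv_eq_mul,
        ENNReal.ofReal_mul (by positivity), ENNReal.ofReal_rpow_of_pos hcpos]
      ring
  have hcont : ContinuousAt
      (fun s : ℝ => volume {z : E n | s < ‖kernel Ω α z * ∫ y, (f y : 𝕜)‖}) 1 := by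
    have h1 : ContinuousAt
        (fun s : ℝ => ENNReal.ofReal (s ^ (-r)) * (A * ENNReal.ofReal c ^ r)) 1 := by
      have h2 : ContinuousAt (fun s : ℝ => ENNReal.ofReal (s ^ (-r))) 1 :=
        ENNReal.continuous_ofReal.continuousAt.comp
          (Real.continuousAt_rpow_const _ _ (Or.inl one_ne_zero))
      exact ENNReal.Tendsto.mul_const h2 (Or.inr (ENNReal.mul_ne_top hAtop
        (ENNReal.rpow_ne_top_of_nonneg hr0.le ENNReal.ofReal_ne_top)))
    refine h1.congr ?_
    filter_upwards [lt_mem_nhds one_pos] with s hs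
    exact (hdist s hs).symm
  have hlim := tendsto_measure_lt_norm_of_tendsto_measure_sub
    (G := fun (ε : ℝ) u => ∫ y, kernel Ω α (u - ε • y) * (f y : 𝕜))
    (fun δ hδ => tendsto_measure_dilated_convolution_sub hKm hK hf hδ) hcont
  rw [hdist 1 one_pos, Real.one_rpow, ENNReal.ofReal_one, one_mul, ← hcf] at hlim
  have hscale : Tendsto (fun t : ℝ => t ^ ((n : ℝ) - α)⁻¹) (𝓝[>] 0) (𝓝[>] 0) := by
    refine tendsto_nhdsWithin_iff.2 ⟨?_, ?_⟩
    · refine Tendsto.mono_left ?_ nhdsWithin_le_nhds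
      have := (Real.continuousAt_rpow_const 0 ((n : ℝ) - α)⁻¹ (Or.inr (inv_pos.2 hβ).le)).tendsto
      rwa [Real.zero_rpow (inv_pos.2 hβ).ne'] at this
    · filter_upwards [self_mem_nhdsWithin] with t ht
      exact Real.rpow_pos_of_pos ht _
  refine (hlim.comp hscale).congr' ?_
  filter_upwards [self_mem_nhdsWithin] with t ht
  exact (volume_lt_norm_fractionalIntegral hα hαn hr hΩ f ht).symm

end Main

end RoughFractional

theorem mainTheorem5 {𝕜 : Type*} [RCLike 𝕜] (n : ℕ) (α r : ℝ) (hα : 0 < α) (hαn : α < n)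
    (hr : r = n / (n - α))
    (Ω : RoughFractional.E n → 𝕜)
    (hΩ_hom : RoughFractional.HomogeneousDegreeZero Ω)
    (hΩ_mean : RoughFractional.MeanZero Ω)
    (hΩ_dini : RoughFractional.DiniCondition (ENNReal.ofReal r) α Ω)
    (f : RoughFractional.E n → ℝ) (hf : Integrable f volume) (hf_nonneg : 0 ≤ᵐ[volume] f) :
    (∀ᵐ x : RoughFractional.E n, Integrable (RoughFractional.integrand Ω α f x) volume) ∧
    Tendsto
      (fun t : ℝ => ENNReal.ofReal (t ^ r) *
        volume {x : RoughFractional.E n | t < ‖RoughFractional.fractionalIntegral Ω α f x‖})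
      (𝓝[>] 0)
      (𝓝 ((n : ℝ≥0∞)⁻¹ *
        eLpNorm (fun θ : RoughFractional.S n => Ω (θ : RoughFractional.E n)) (ENNReal.ofReal r)
          (RoughFractional.area n) ^ r *
        eLpNorm f 1 volume ^ r)) :=
  ⟨RoughFractional.ae_integrable_integrand hα hαn hr hΩ_hom hΩ_dini.memLp hf,
    RoughFractional.tendsto_rpow_mul_volume_lt_norm_fractionalIntegral hα hαn hr hΩ_hom
      hΩ_dini.memLp hf hf_nonneg⟩
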